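/- A quantum channel with input space $\mathbb{C}^{d_A}$ and output space $\mathbb{C}^{d_B}$ is a completely positive trace-preserving linear map $\mathcal{N}$ from $d_A\times d_A$ to $d_B\times d_B$ complex matrices. For positive integers $n,n'$, the $[n]\to[n']$ communication value of $\mathcal{N}$ is $$\mathrm{cv}^{n\to n'}(\mathcal{N})=\max_{\{\rho_x\}_{x=1}^{n},\ \{\Pi_y\}_{y=1}^{n'}}\ \sum_{y=1}^{n'}\max_{1\le x\le n}\mathrm{Tr}\big[\Pi_y\,\mathcal{N}(\rho_x)\big],$$ where $\rho_1,\dots,\rho_n$ range over density operators (positive semidefinite, trace one) on the input space and $\{\Pi_y\}_{y=1}^{n'}$ over the POVMs on the output space (positive semidefinite operators with $\sum_y\Pi_y=\mathbb{I}$). The communication value of $\mathcal{N}$ is $$\mathrm{cv}(\mathcal{N})=\sup_{n,n'\ge 1}\mathrm{cv}^{n\to n'}(\mathcal{N}).$$ **Theorem.** Let $\mathcal{M}$ and $\mathcal{N}$ be qubit channels, i.e. channels with $d_A=d_B=2$. Then $$\mathrm{cv}(\mathcal{M}\otimes\mathcal{N})=\mathrm{cv}(\mathcal{M})\,\mathrm{cv}(\mathcal{N}).$$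 -/

import Mathlib

open scoped Kronecker ComplexOrder

/-!
Finite-dimensional quantum systems are represented by `ℂ^a` for a finite index type `a`; operators
on such a system are matrices `Matrix a a ℂ`, and the composite of the systems `a` and `a'` is
`a × a'`, with `⊗ₖ` (Kronecker product) as the tensor product of operators.
-/

namespace QChannel

/-- The tensor product `Φ ⊗ Ψ` of two linear maps between matrix spaces: the unique linear map with
`(Φ ⊗ Ψ) (X ⊗ₖ Y) = Φ X ⊗ₖ Ψ Y`. -/
noncomputable def tensorMap {a b a' b' : Type*}
    [Fintype a] [DecidableEq a] [Fintype b] [DecidableEq b]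
    [Fintype a'] [DecidableEq a'] [Fintype b'] [DecidableEq b']
    (Φ : Matrix a a ℂ →ₗ[ℂ] Matrix b b ℂ) (Ψ : Matrix a' a' ℂ →ₗ[ℂ] Matrix b' b' ℂ) :
    Matrix (a × a') (a × a') ℂ →ₗ[ℂ] Matrix (b × b') (b × b') ℂ :=
  (kroneckerLinearEquiv b b b' b' ℂ).toLinearMap ∘ₗ TensorProduct.map Φ Ψ ∘ₗ
    (kroneckerLinearEquiv a a a' a' ℂ).symm.toLinearMap

/-- A linear map `Φ` is completely positive if `id_k ⊗ Φ` maps positive operators to positive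
operators for every `k`. -/
def IsCompletelyPositive {a b : Type*} [Fintype a] [DecidableEq a] [Fintype b] [DecidableEq b]
    (Φ : Matrix a a ℂ →ₗ[ℂ] Matrix b b ℂ) : Prop :=
  ∀ (k : ℕ) (X : Matrix (Fin k × a) (Fin k × a) ℂ), X.PosSemidef →
    (tensorMap (LinearMap.id : Matrix (Fin k) (Fin k) ℂ →ₗ[ℂ] Matrix (Fin k) (Fin k) ℂ) Φ
      X).PosSemidef

/-- A map is trace preserving if `Tr (Φ X) = Tr X` for all `X`. -/
def IsTracePreserving {a b : Type*} [Fintype a] [Fintype b]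
    (Φ : Matrix a a ℂ →ₗ[ℂ] Matrix b b ℂ) : Prop :=
  ∀ X : Matrix a a ℂ, (Φ X).trace = X.trace

/-- Quantum channels: completely positive trace-preserving (CPTP) linear maps. -/
structure Channel (a b : Type*) [Fintype a] [DecidableEq a] [Fintype b] [DecidableEq b] where
  toLinearMap : Matrix a a ℂ →ₗ[ℂ] Matrix b b ℂ
  completelyPositive : IsCompletelyPositive toLinearMap
  tracePreserving : IsTracePreserving toLinearMap

section TensorLemmas

variable {a b a' b' c c' : Type*}
  [Fintype a] [DecidableEq a] [Fintype b] [DecidableEq b]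
  [Fintype a'] [DecidableEq a'] [Fintype b'] [DecidableEq b']
  [Fintype c] [DecidableEq c] [Fintype c'] [DecidableEq c']

theorem tensorMap_kronecker (Φ : Matrix a a ℂ →ₗ[ℂ] Matrix b b ℂ)
    (Ψ : Matrix a' a' ℂ →ₗ[ℂ] Matrix b' b' ℂ) (X : Matrix a a ℂ) (Y : Matrix a' a' ℂ) :
    tensorMap Φ Ψ (X ⊗ₖ Y) = Φ X ⊗ₖ Ψ Y := by
  simp [tensorMap]

/-- Linear maps on a composite matrix space agree if they agree on Kronecker products. -/
theorem kronecker_ext {V : Type*} [AddCommMonoid V] [Module ℂ V]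
    {F G : Matrix (a × a') (a × a') ℂ →ₗ[ℂ] V}
    (h : ∀ (X : Matrix a a ℂ) (Y : Matrix a' a' ℂ), F (X ⊗ₖ Y) = G (X ⊗ₖ Y)) : F = G := by
  have : F ∘ₗ (kroneckerLinearEquiv a a a' a' ℂ).toLinearMap =
      G ∘ₗ (kroneckerLinearEquiv a a a' a' ℂ).toLinearMap := by
    apply TensorProduct.ext'
    intro X Y
    simpa using h X Y
  ext1 Z
  have h2 := LinearMap.congr_fun this ((kroneckerLinearEquiv a a a' a' ℂ).symm Z)
  simpa using h2

/-- `id ⊗ Φ` acts blockwise. -/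
theorem tensorMap_id_left_apply (Φ : Matrix a a ℂ →ₗ[ℂ] Matrix b b ℂ)
    (X : Matrix (c × a) (c × a) ℂ) (p q : c × b) :
    tensorMap (LinearMap.id : Matrix c c ℂ →ₗ[ℂ] Matrix c c ℂ) Φ X p q =
      Φ (X.submatrix (fun i => (p.1, i)) (fun j => (q.1, j))) p.2 q.2 := by
  let S : Matrix (c × a) (c × a) ℂ →ₗ[ℂ] Matrix a a ℂ :=
    { toFun := fun X => X.submatrix (fun i => (p.1, i)) (fun j => (q.1, j))
      map_add' := fun _ _ => rfl
      map_smul' := fun _ _ => rfl }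
  have key : Matrix.entryLinearMap ℂ ℂ p q ∘ₗ
      tensorMap (LinearMap.id : Matrix c c ℂ →ₗ[ℂ] Matrix c c ℂ) Φ =
      Matrix.entryLinearMap ℂ ℂ p.2 q.2 ∘ₗ Φ ∘ₗ S := by
    apply kronecker_ext
    intro Y Z
    have hS : S (Y ⊗ₖ Z) = Y p.1 q.1 • Z := by
      ext i j
      rfl
    simp [tensorMap_kronecker, hS, Matrix.kroneckerMap_apply]
  exact LinearMap.congr_fun key X

/-- `Φ ⊗ id` acts blockwise. -/
theorem tensorMap_id_right_apply (Φ : Matrix a a ℂ →ₗ[ℂ] Matrix b b ℂ)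
    (X : Matrix (a × c) (a × c) ℂ) (p q : b × c) :
    tensorMap Φ (LinearMap.id : Matrix c c ℂ →ₗ[ℂ] Matrix c c ℂ) X p q =
      Φ (X.submatrix (fun i => (i, p.2)) (fun j => (j, q.2))) p.1 q.1 := by
  let S : Matrix (a × c) (a × c) ℂ →ₗ[ℂ] Matrix a a ℂ :=
    { toFun := fun X => X.submatrix (fun i => (i, p.2)) (fun j => (j, q.2))
      map_add' := fun _ _ => rfl
      map_smul' := fun _ _ => rfl }
  have key : Matrix.entryLinearMap ℂ ℂ p q ∘ₗ
      tensorMap Φ (LinearMap.id : Matrix c c ℂ →ₗ[ℂ] Matrix c c ℂ) =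
      Matrix.entryLinearMap ℂ ℂ p.1 q.1 ∘ₗ Φ ∘ₗ S := by
    apply kronecker_ext
    intro Y Z
    have hS : S (Y ⊗ₖ Z) = Z p.2 q.2 • Y := by
      ext i j
      exact mul_comm _ _
    simp [tensorMap_kronecker, hS, Matrix.kroneckerMap_apply, mul_comm]
  exact LinearMap.congr_fun key X

/-- Positivity of `id ⊗ Φ` for an ancilla with an arbitrary finite index type. -/
theorem IsCompletelyPositive.posSemidef {Φ : Matrix a a ℂ →ₗ[ℂ] Matrix b b ℂ}
    (h : IsCompletelyPositive Φ) {X : Matrix (c × a) (c × a) ℂ} (hX : X.PosSemidef) :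
    (tensorMap (LinearMap.id : Matrix c c ℂ →ₗ[ℂ] Matrix c c ℂ) Φ X).PosSemidef := by
  let e := Fintype.equivFin c
  have h1 := h (Fintype.card c) _ (hX.submatrix (fun p => (e.symm p.1, p.2)))
  have h2 := h1.submatrix (fun p : c × b => (e p.1, p.2))
  convert h2 using 1
  ext p q
  simp [tensorMap_id_left_apply, Matrix.submatrix_submatrix, Function.comp_def]

theorem IsCompletelyPositive.tensorMap {Φ : Matrix a a ℂ →ₗ[ℂ] Matrix b b ℂ}
    {Ψ : Matrix a' a' ℂ →ₗ[ℂ] Matrix b' b' ℂ}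
    (hΦ : IsCompletelyPositive Φ) (hΨ : IsCompletelyPositive Ψ) :
    IsCompletelyPositive (tensorMap Φ Ψ) := by
  intro k X hX
  have hcomp : QChannel.tensorMap Φ Ψ =
      QChannel.tensorMap Φ (LinearMap.id : Matrix b' b' ℂ →ₗ[ℂ] Matrix b' b' ℂ) ∘ₗ
        QChannel.tensorMap (LinearMap.id : Matrix a a ℂ →ₗ[ℂ] Matrix a a ℂ) Ψ := by
    apply kronecker_ext
    intro Y Z
    simp [tensorMap_kronecker]
  -- first apply `Ψ` with ancilla `Fin k × a`, then `Φ` with ancilla `Fin k × b'`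
  have h1 := hΨ.posSemidef (c := Fin k × a)
    (hX.submatrix (fun p : (Fin k × a) × a' => (p.1.1, (p.1.2, p.2))))
  have h2 := hΦ.posSemidef (c := Fin k × b')
    (h1.submatrix (fun p : (Fin k × b') × a => ((p.1.1, p.2), p.1.2)))
  have h3 := h2.submatrix (fun p : Fin k × (b × b') => ((p.1, p.2.2), p.2.1))
  convert h3 using 1
  ext p q
  rw [tensorMap_id_left_apply, hcomp, LinearMap.comp_apply, tensorMap_id_right_apply,
    Matrix.submatrix_apply, tensorMap_id_left_apply]
  refine congrArg (fun Z => Φ Z p.2.1 q.2.1) ?_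
  ext i j
  simp [tensorMap_id_left_apply, Matrix.submatrix_submatrix, Function.comp_def]

theorem IsTracePreserving.tensorMap {Φ : Matrix a a ℂ →ₗ[ℂ] Matrix b b ℂ}
    {Ψ : Matrix a' a' ℂ →ₗ[ℂ] Matrix b' b' ℂ}
    (hΦ : IsTracePreserving Φ) (hΨ : IsTracePreserving Ψ) :
    IsTracePreserving (tensorMap Φ Ψ) := by
  have key : Matrix.traceLinearMap (b × b') ℂ ℂ ∘ₗ QChannel.tensorMap Φ Ψ =
      Matrix.traceLinearMap (a × a') ℂ ℂ := by
    apply kronecker_ext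
    intro Y Z
    simp [tensorMap_kronecker, Matrix.trace_kronecker, hΦ Y, hΨ Z]
  intro X
  exact LinearMap.congr_fun key X

end TensorLemmas

/-- The channel `M ⊗ N`: the parallel use of the channels `M` and `N`. -/
noncomputable def Channel.tensor {a b a' b' : Type*}
    [Fintype a] [DecidableEq a] [Fintype b] [DecidableEq b]
    [Fintype a'] [DecidableEq a'] [Fintype b'] [DecidableEq b']
    (M : Channel a b) (N : Channel a' b') : Channel (a × a') (b × b') where
  toLinearMap := tensorMap M.toLinearMap N.toLinearMap
  completelyPositive := M.completelyPositive.tensorMap N.completelyPositive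
  tracePreserving := M.tracePreserving.tensorMap N.tracePreserving

/-- Density operators: positive operators of unit trace. -/
def IsDensity {a : Type*} [Fintype a] (ρ : Matrix a a ℂ) : Prop :=
  ρ.PosSemidef ∧ ρ.trace = 1

/-- A positive operator-valued measure (POVM) with finitely many outcomes `y : Y`. -/
def IsPOVM {b Y : Type*} [Fintype b] [DecidableEq b] [Fintype Y] (E : Y → Matrix b b ℂ) : Prop :=
  (∀ y, (E y).PosSemidef) ∧ ∑ y, E y = 1

/-- The communication value `∑_y max_x P(y|x)` of a classical channel, given by its transition
probabilities `P x y = P(y|x)`. -/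
noncomputable def classicalCV {X Y : Type*} [Fintype Y] (P : X → Y → ℝ) : ℝ :=
  ∑ y, ⨆ x, P x y

/-- The classical channel `P(y|x) = Tr[Π_y N(ρ_x)]` generated by `N`, the encoding `ρ` and the
POVM `E`. (For states and POVMs this trace is a real number.) -/
noncomputable def inducedChannel {a b X Y : Type*}
    [Fintype a] [DecidableEq a] [Fintype b] [DecidableEq b]
    (N : Channel a b) (ρ : X → Matrix a a ℂ) (E : Y → Matrix b b ℂ) : X → Y → ℝ :=
  fun x y => (E y * N.toLinearMap (ρ x)).trace.re

/-- The values `cv(P)` of the classical channels `P : [n] → [n']` generated by `N`. -/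
def cvValues {a b : Type*} [Fintype a] [DecidableEq a] [Fintype b] [DecidableEq b]
    (N : Channel a b) (n n' : ℕ) : Set ℝ :=
  {v | ∃ (ρ : Fin n → Matrix a a ℂ) (E : Fin n' → Matrix b b ℂ),
    (∀ x, IsDensity (ρ x)) ∧ IsPOVM E ∧ v = classicalCV (inducedChannel N ρ E)}

/-- The `[n] → [n']` communication value of `N`: the maximum of `cvValues N n n'`. -/
noncomputable def cvFin {a b : Type*} [Fintype a] [DecidableEq a] [Fintype b] [DecidableEq b]
    (N : Channel a b) (n n' : ℕ) : ℝ :=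
  sSup (cvValues N n n')

/-- The communication value of `N`: the supremum of its `[n] → [n']` communication values over all
positive integers `n` and `n'`. -/
noncomputable def cv {a b : Type*} [Fintype a] [DecidableEq a] [Fintype b] [DecidableEq b]
    (N : Channel a b) : ℝ :=
  ⨆ p : ℕ+ × ℕ+, cvFin N p.1 p.2

section WellDefined

variable {a b : Type*} [Fintype a] [DecidableEq a] [Fintype b] [DecidableEq b]

theorem trace_mul_nonneg {P Q : Matrix b b ℂ} (hP : P.PosSemidef) (hQ : Q.PosSemidef) :
    0 ≤ (P * Q).trace := by
  obtain ⟨B, rfl⟩ : ∃ B : Matrix b b ℂ, Q = B.conjTranspose * B := by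
    open scoped MatrixOrder in
    exact CStarAlgebra.nonneg_iff_eq_star_mul_self.mp hQ.nonneg
  rw [← Matrix.mul_assoc, Matrix.trace_mul_comm, ← Matrix.mul_assoc]
  exact (hP.mul_mul_conjTranspose_same B).trace_nonneg

/-- Channels map density operators to density operators. -/
theorem Channel.isDensity (N : Channel a b) {ρ : Matrix a a ℂ} (h : IsDensity ρ) :
    IsDensity (N.toLinearMap ρ) := by
  refine ⟨?_, by rw [N.tracePreserving, h.2]⟩
  have h1 := N.completelyPositive.posSemidef (c := Unit)
    (h.1.submatrix (fun p : Unit × a => p.2))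
  have h2 := h1.submatrix (fun i : b => ((), i))
  convert h2 using 1
  ext i j
  rw [Matrix.submatrix_apply, tensorMap_id_left_apply]
  rfl

theorem IsDensity.one_sub_posSemidef {σ : Matrix b b ℂ} (h : IsDensity σ) : (1 - σ).PosSemidef := by
  have hH := h.1.isHermitian
  have hs : ∑ i, hH.eigenvalues i = 1 := by
    have := hH.trace_eq_sum_eigenvalues
    rw [h.2] at this
    have h' := this.symm
    rw [← Complex.ofReal_one] at h'
    apply Complex.ofReal_injective
    rw [← h']
    simp
  have hle : ∀ i, hH.eigenvalues i ≤ 1 := fun i => by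
    rw [← hs]
    exact Finset.single_le_sum (fun j _ => h.1.eigenvalues_nonneg j) (Finset.mem_univ i)
  have hd : (Matrix.diagonal (fun i => (1 - hH.eigenvalues i : ℂ))).PosSemidef := by
    refine Matrix.PosSemidef.diagonal (fun i => ?_)
    have := hle i
    simp only [Pi.zero_apply]
    rw [sub_nonneg]
    exact_mod_cast this
  have := hd.mul_mul_conjTranspose_same (hH.eigenvectorUnitary : Matrix b b ℂ)
  convert this using 1
  have hsp := hH.spectral_theorem
  have hu : (hH.eigenvectorUnitary : Matrix b b ℂ) * (hH.eigenvectorUnitary : Matrix b b ℂ).conjTranspose = 1 :=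
    Unitary.coe_mul_star_self _
  have : Matrix.diagonal (fun i => (1 - hH.eigenvalues i : ℂ)) = 1 - Matrix.diagonal (fun i => (hH.eigenvalues i : ℂ)) := by
    rw [← Matrix.diagonal_one, Matrix.diagonal_sub]
  rw [this, Matrix.mul_sub, Matrix.sub_mul, Matrix.mul_one, hu]
  congr 1

/-- Every value in the definition of the communication value is at most the output dimension. -/
theorem le_card_of_mem_cvValues (N : Channel a b) {n n' : ℕ} (hn : 0 < n) {v : ℝ} (hv : v ∈ cvValues N n n') :
    v ≤ Fintype.card b := by
  obtain ⟨ρ, E, hρ, hE, rfl⟩ := hv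
  have : Nonempty (Fin n) := ⟨⟨0, hn⟩⟩
  have : ∀ y, ⨆ x, inducedChannel N ρ E x y ≤ (E y).trace.re := fun y => by
    refine ciSup_le fun x => ?_
    have h := trace_mul_nonneg (hE.1 y) (N.isDensity (hρ x)).one_sub_posSemidef
    rw [Matrix.mul_sub, Matrix.trace_sub, Matrix.mul_one] at h
    have := (Complex.le_def.mp h).1
    simp at this
    simpa [inducedChannel] using this
  calc _ ≤ ∑ y, (E y).trace.re := Finset.sum_le_sum fun y _ => this y
    _ = _ := by rw [← Complex.re_sum, ← Matrix.trace_sum, hE.2]; simp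

theorem cvFin_le (N : Channel a b) (p : ℕ+ × ℕ+) : cvFin N p.1 p.2 ≤ Fintype.card b :=
  Real.sSup_le (fun _ hv => le_card_of_mem_cvValues N p.1.pos hv) (by positivity)

/-- The supremum that defines `cv N` is over a bounded set of reals. -/
theorem bddAbove_range_cvFin (N : Channel a b) : BddAbove (Set.range fun p : ℕ+ × ℕ+ => cvFin N p.1 p.2) :=
  ⟨Fintype.card b, by rintro _ ⟨p, rfl⟩; exact cvFin_le N p⟩

end WellDefined

end QChannel

/-! On Bloch vectors a qubit channel `M` is affine. Let `s` be the largest singular value of its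
linear part and `D = M(1)`. Then `cv M = 1 + s`: a binary code along the top singular direction
attains this value, and `Z = (s • 1 + D) / 2`, of trace `1 + s`, dominates every output `M(ρ)`,
which bounds every code because a POVM sums to `1` (`sum_trace_le_cv`, `cv_le_of_dominates`).
Product codes give one inequality for `M ⊗ N`; what remains is that `Z ⊗ Z'` dominates all outputs
of `M ⊗ N`, those of entangled inputs included.

Let `T X = Tr X • Z` and let `f` be the spin flip. The map `T - M` sends `1` to `s • 1`, and its
Bloch coefficients lie in the cube `[-s, s]^3`, whose vertices are `s` times a rotation or a
rotation after `f`. Hence `T - M = K + L ∘ f` with `K`, `L` completely positive, and `det D ≥ s^2`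
makes `2T - L` completely positive (`exists_dominating`). Since `T ∘ f = T`, the difference `T ⊗ T'
- M ⊗ N` equals `K ⊗ N + M ⊗ K' + K ⊗ K'` plus half of `((2T - L) ⊗ L' + L ⊗ (2T' - L')) ∘ (f ⊗ f)`.
Although `f` is not completely positive, `f ⊗ f` is positive, being a global transposition up to a
congruence (`posSemidef_kronecker_sub_tensor`). -/

namespace QChannel

/-! ### Completely positive maps and Choi matrices. -/

section CompletelyPositive

variable {a b a' b' c : Type*}
  [Fintype a] [DecidableEq a] [Fintype b] [DecidableEq b]
  [Fintype a'] [DecidableEq a'] [Fintype b'] [DecidableEq b'] [Fintype c] [DecidableEq c]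

theorem tensorMap_add_right (Φ : Matrix a a ℂ →ₗ[ℂ] Matrix b b ℂ)
    (Ψ Ψ' : Matrix a' a' ℂ →ₗ[ℂ] Matrix b' b' ℂ) :
    tensorMap Φ (Ψ + Ψ') = tensorMap Φ Ψ + tensorMap Φ Ψ' := by
  apply kronecker_ext
  intro X Y
  simp [tensorMap_kronecker, Matrix.kronecker_add]

theorem tensorMap_smul_right (Φ : Matrix a a ℂ →ₗ[ℂ] Matrix b b ℂ)
    (Ψ : Matrix a' a' ℂ →ₗ[ℂ] Matrix b' b' ℂ) (r : ℂ) :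
    tensorMap Φ (r • Ψ) = r • tensorMap Φ Ψ := by
  apply kronecker_ext
  intro X Y
  simp [tensorMap_kronecker, Matrix.kronecker_smul]

theorem IsCompletelyPositive.zero :
    IsCompletelyPositive (0 : Matrix a a ℂ →ₗ[ℂ] Matrix b b ℂ) := by
  intro k X _
  have h : QChannel.tensorMap (LinearMap.id : Matrix (Fin k) (Fin k) ℂ →ₗ[ℂ] _)
      (0 : Matrix a a ℂ →ₗ[ℂ] Matrix b b ℂ) = 0 := by
    apply kronecker_ext
    intro X Y
    simp [tensorMap_kronecker]
  rw [h]
  exact Matrix.PosSemidef.zero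

theorem IsCompletelyPositive.add {Φ Ψ : Matrix a a ℂ →ₗ[ℂ] Matrix b b ℂ}
    (hΦ : IsCompletelyPositive Φ) (hΨ : IsCompletelyPositive Ψ) :
    IsCompletelyPositive (Φ + Ψ) := by
  intro k X hX
  rw [tensorMap_add_right]
  exact (hΦ k X hX).add (hΨ k X hX)

theorem IsCompletelyPositive.smul {Φ : Matrix a a ℂ →ₗ[ℂ] Matrix b b ℂ}
    (hΦ : IsCompletelyPositive Φ) {r : ℂ} (hr : 0 ≤ r) : IsCompletelyPositive (r • Φ) := by
  intro k X hX
  rw [tensorMap_smul_right]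
  exact (hΦ k X hX).smul hr

theorem IsCompletelyPositive.sum {ι : Type*} (s : Finset ι)
    {Φ : ι → Matrix a a ℂ →ₗ[ℂ] Matrix b b ℂ} (h : ∀ i ∈ s, IsCompletelyPositive (Φ i)) :
    IsCompletelyPositive (∑ i ∈ s, Φ i) := by
  classical
  induction s using Finset.induction_on with
  | empty => simpa using IsCompletelyPositive.zero
  | insert i s hi ih =>
    rw [Finset.sum_insert hi]
    exact (h i (by simp)).add (ih fun j hj => h j (by simp [hj]))

/-- Completely positive maps are positive. -/
theorem IsCompletelyPositive.posSemidef_apply {Φ : Matrix a a ℂ →ₗ[ℂ] Matrix b b ℂ}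
    (h : IsCompletelyPositive Φ) {X : Matrix a a ℂ} (hX : X.PosSemidef) : (Φ X).PosSemidef := by
  have h1 := h.posSemidef (c := Unit) (hX.submatrix (fun p : Unit × a => p.2))
  convert h1.submatrix (fun i : b => ((), i)) using 1
  ext i j
  rw [Matrix.submatrix_apply, tensorMap_id_left_apply]
  rfl

/-- The map `X ↦ K X Kᴴ`. -/
noncomputable def congruence (K : Matrix b a ℂ) : Matrix a a ℂ →ₗ[ℂ] Matrix b b ℂ where
  toFun X := K * X * K.conjTranspose
  map_add' X Y := by simp [Matrix.mul_add, Matrix.add_mul]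
  map_smul' r X := by simp

theorem congruence_apply (K : Matrix b a ℂ) (X : Matrix a a ℂ) :
    congruence K X = K * X * K.conjTranspose := rfl

theorem isCompletelyPositive_congruence (K : Matrix b a ℂ) :
    IsCompletelyPositive (congruence K) := by
  intro k X hX
  have h : tensorMap (LinearMap.id : Matrix (Fin k) (Fin k) ℂ →ₗ[ℂ] _) (congruence K) =
      congruence ((1 : Matrix (Fin k) (Fin k) ℂ) ⊗ₖ K) := by
    apply kronecker_ext
    intro X Y
    simp [tensorMap_kronecker, congruence_apply, Matrix.conjTranspose_kronecker,
      ← Matrix.mul_kronecker_mul]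
  rw [h]
  exact hX.mul_mul_conjTranspose_same _

/-- The Choi matrix of a linear map between matrix spaces. -/
noncomputable def choi (Φ : Matrix a a ℂ →ₗ[ℂ] Matrix b b ℂ) : Matrix (a × b) (a × b) ℂ :=
  Matrix.of fun p q => Φ (Matrix.single p.1 q.1 1) p.2 q.2

theorem apply_eq_sum_choi (Φ : Matrix a a ℂ →ₗ[ℂ] Matrix b b ℂ) (X : Matrix a a ℂ) (p q : b) :
    Φ X p q = ∑ i, ∑ j, X i j * choi Φ (i, p) (j, q) := by
  have h : Φ X = ∑ i, ∑ j, X i j • Φ (Matrix.single i j 1) := by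
    conv_lhs => rw [Matrix.matrix_eq_sum_single X]
    simp only [map_sum, ← map_smul, Matrix.smul_single, smul_eq_mul, mul_one]
  rw [h]
  simp [Matrix.sum_apply, choi]

/-- A map with positive Choi matrix is completely positive. -/
theorem isCompletelyPositive_of_choi {Φ : Matrix a a ℂ →ₗ[ℂ] Matrix b b ℂ}
    (h : (choi Φ).PosSemidef) : IsCompletelyPositive Φ := by
  obtain ⟨B, hB⟩ : ∃ B : Matrix (a × b) (a × b) ℂ, choi Φ = B.conjTranspose * B := by
    open scoped MatrixOrder in
    exact CStarAlgebra.nonneg_iff_eq_star_mul_self.mp h.nonneg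
  -- Each row of `B`, conjugated and reshaped, is a Kraus operator of `Φ`.
  have hΦ : Φ = ∑ r, congruence (Matrix.of fun p i => star (B r (i, p))) := by
    ext1 X
    ext p q
    rw [apply_eq_sum_choi, hB]
    simp only [LinearMap.sum_apply, Matrix.sum_apply, congruence_apply, Matrix.mul_apply,
      Matrix.conjTranspose_apply, Matrix.of_apply, Finset.mul_sum, Finset.sum_mul, star_star]
    rw [Finset.sum_comm]
    simp_rw [fun j => Finset.sum_comm (s := (Finset.univ : Finset a))
      (t := (Finset.univ : Finset (a × b)))
      (f := fun i r => X i j * (star (B r (i, p)) * B r (j, q)))]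
    rw [Finset.sum_comm]
    refine Finset.sum_congr rfl fun r _ => Finset.sum_congr rfl fun j _ =>
      Finset.sum_congr rfl fun i _ => by ring
  rw [hΦ]
  exact IsCompletelyPositive.sum _ fun r _ => isCompletelyPositive_congruence _

end CompletelyPositive

/-! ### Upper and lower bounds on the communication value. -/

section Bounds

variable {a b : Type*} [Fintype a] [DecidableEq a] [Fintype b] [DecidableEq b]

/-- An operator that dominates all outputs of `N` bounds the communication value of `N`. -/
theorem cv_le_of_dominates (N : Channel a b) {Z : Matrix b b ℂ} (hZ : 0 ≤ Z.trace.re)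
    (h : ∀ ρ, IsDensity ρ → (Z - N.toLinearMap ρ).PosSemidef) : cv N ≤ Z.trace.re := by
  refine ciSup_le fun p => Real.sSup_le ?_ hZ
  rintro _ ⟨ρ, E, hρ, hE, rfl⟩
  have : Nonempty (Fin p.1) := ⟨⟨0, p.1.pos⟩⟩
  -- The bound does not depend on the input, so the maximum over `x` disappears and the sum over
  -- outcomes collapses to `Tr Z`.
  have key : ∀ y, ⨆ x, inducedChannel N ρ E x y ≤ (E y * Z).trace.re := fun y => by
    refine ciSup_le fun x => ?_
    have h := trace_mul_nonneg (hE.1 y) (h _ (hρ x))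
    rw [Matrix.mul_sub, Matrix.trace_sub] at h
    have := (Complex.le_def.mp h).1
    simp at this
    simpa [inducedChannel] using this
  calc _ ≤ ∑ y, (E y * Z).trace.re := Finset.sum_le_sum fun y _ => key y
    _ = _ := by rw [← Complex.re_sum, ← Matrix.trace_sum, ← Finset.sum_mul, hE.2, one_mul]

/-- Every encoding and decoding with a common alphabet bounds the communication value below. -/
theorem sum_trace_le_cv {Y : Type*} [Fintype Y] [Nonempty Y] (N : Channel a b)
    {ρ : Y → Matrix a a ℂ} {E : Y → Matrix b b ℂ} (hρ : ∀ y, IsDensity (ρ y)) (hE : IsPOVM E) :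
    ∑ y, (E y * N.toLinearMap (ρ y)).trace.re ≤ cv N := by
  let e := (Fintype.equivFin Y).symm
  let n : ℕ+ := ⟨Fintype.card Y, Fintype.card_pos⟩
  have hmem : classicalCV (inducedChannel N (ρ ∘ e) (E ∘ e)) ∈ cvValues N n n :=
    ⟨ρ ∘ e, E ∘ e, fun x => hρ _, ⟨fun y => hE.1 _, by
      rw [← hE.2]; exact Equiv.sum_comp e E⟩, rfl⟩
  have h1 : classicalCV (inducedChannel N (ρ ∘ e) (E ∘ e)) ≤ cvFin N n n :=
    le_csSup ⟨_, fun v hv => le_card_of_mem_cvValues N n.pos hv⟩ hmem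
  have h2 : cvFin N n n ≤ cv N := le_ciSup (bddAbove_range_cvFin N) (n, n)
  refine le_trans ?_ (h1.trans h2)
  rw [← Equiv.sum_comp e]
  -- The input labelled `y` is one candidate in the maximum for outcome `y`.
  exact Finset.sum_le_sum fun y _ => le_ciSup
    (f := fun x => inducedChannel N (ρ ∘ e) (E ∘ e) x y) (Set.finite_range _).bddAbove y

end Bounds

/-! ### Spin flip, Pauli triples and maps in Bloch form. -/

section Pauli

/-- The spin flip `X ↦ Tr X - X` of a qubit. -/
noncomputable def spinFlip : Matrix (Fin 2) (Fin 2) ℂ →ₗ[ℂ] Matrix (Fin 2) (Fin 2) ℂ where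
  toFun X := X.trace • (1 : Matrix (Fin 2) (Fin 2) ℂ) - X
  map_add' X Y := by simp only [Matrix.trace_add, add_smul]; abel
  map_smul' r X := by simp [smul_sub, smul_smul]

theorem spinFlip_apply (X : Matrix (Fin 2) (Fin 2) ℂ) :
    spinFlip X = X.trace • (1 : Matrix (Fin 2) (Fin 2) ℂ) - X := rfl

/-- This is Cayley–Hamilton in dimension two. It lets `spinFlip Y` serve as `det Y` times the
inverse of `Y`. -/
theorem spinFlip_eq_adjugate (X : Matrix (Fin 2) (Fin 2) ℂ) : spinFlip X = X.adjugate := by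
  rw [spinFlip_apply, Matrix.adjugate_fin_two]
  ext i j
  fin_cases i <;> fin_cases j <;> simp [Matrix.trace_fin_two]

theorem trace_spinFlip (X : Matrix (Fin 2) (Fin 2) ℂ) : (spinFlip X).trace = X.trace := by
  simp [spinFlip_apply, Matrix.trace_fin_two]
  ring

/-- The antisymmetric matrix implementing the spin flip. -/
def symplectic : Matrix (Fin 2) (Fin 2) ℂ := !![0, 1; -1, 0]

theorem spinFlip_eq_conj_transpose (X : Matrix (Fin 2) (Fin 2) ℂ) :
    spinFlip X = symplectic * X.transpose * symplectic.conjTranspose := by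
  rw [spinFlip_eq_adjugate, Matrix.adjugate_fin_two]
  ext i j
  fin_cases i <;> fin_cases j <;>
    simp [symplectic, Matrix.mul_apply, Fin.sum_univ_two, Matrix.vecMul, Matrix.vecHead, Matrix.vecTail]

theorem posSemidef_spinFlip {X : Matrix (Fin 2) (Fin 2) ℂ} (hX : X.PosSemidef) :
    (spinFlip X).PosSemidef := by
  rw [spinFlip_eq_conj_transpose]
  exact hX.transpose.mul_mul_conjTranspose_same _

/-- The joint spin flip of two qubits is positive. -/
theorem posSemidef_tensorMap_spinFlip {X : Matrix (Fin 2 × Fin 2) (Fin 2 × Fin 2) ℂ}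
    (hX : X.PosSemidef) : (tensorMap spinFlip spinFlip X).PosSemidef := by
  -- Two local transpositions make one global transposition, which preserves positivity; a
  -- transposition of one factor alone would not.
  have h : tensorMap spinFlip spinFlip =
      congruence (symplectic ⊗ₖ symplectic) ∘ₗ
        (Matrix.transposeLinearEquiv (Fin 2 × Fin 2) (Fin 2 × Fin 2) ℂ ℂ).toLinearMap := by
    apply kronecker_ext
    intro X Y
    have : (X ⊗ₖ Y).transpose = X.transpose ⊗ₖ Y.transpose := rfl
    simp [tensorMap_kronecker, spinFlip_eq_conj_transpose, congruence_apply, this,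
      Matrix.conjTranspose_kronecker, ← Matrix.mul_kronecker_mul]
  rw [h]
  exact hX.transpose.mul_mul_conjTranspose_same _

/-- Triples of qubit observables that satisfy the relations of the Pauli matrices. -/
structure IsPauliTriple (V : Fin 3 → Matrix (Fin 2) (Fin 2) ℂ) : Prop where
  herm : ∀ i, (V i).conjTranspose = V i
  sq : ∀ i, V i * V i = 1
  mul01 : V 0 * V 1 = Complex.I • V 2
  mul12 : V 1 * V 2 = Complex.I • V 0
  mul20 : V 2 * V 0 = Complex.I • V 1
  trace : ∀ i, (V i).trace = 0
  expand : ∀ X, (2 : ℂ) • X = X.trace • (1 : Matrix (Fin 2) (Fin 2) ℂ) +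
    ∑ i, (V i * X).trace • V i

namespace IsPauliTriple

variable {V W : Fin 3 → Matrix (Fin 2) (Fin 2) ℂ}

theorem mul10 (h : IsPauliTriple V) : V 1 * V 0 = -Complex.I • V 2 := by
  have := congrArg Matrix.conjTranspose h.mul01
  simpa [h.herm] using this

theorem mul21 (h : IsPauliTriple V) : V 2 * V 1 = -Complex.I • V 0 := by
  have := congrArg Matrix.conjTranspose h.mul12
  simpa [h.herm] using this

theorem mul02 (h : IsPauliTriple V) : V 0 * V 2 = -Complex.I • V 1 := by
  have := congrArg Matrix.conjTranspose h.mul20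
  simpa [h.herm] using this

/-- Signs with product one may be distributed over a Pauli triple. -/
theorem signed (h : IsPauliTriple V) {e : Fin 3 → ℂ} (he : ∀ i, e i = 1 ∨ e i = -1)
    (hp : e 0 * e 1 * e 2 = 1) : IsPauliTriple fun i => e i • V i := by
  have hsq : ∀ i, e i * e i = 1 := fun i => by rcases he i with h | h <;> simp [h]
  have hstar : ∀ i, star (e i) = e i := fun i => by rcases he i with h | h <;> simp [h]
  refine ⟨fun i => ?_, fun i => ?_, ?_, ?_, ?_, fun i => ?_, fun X => ?_⟩
  · rw [Matrix.conjTranspose_smul, hstar, h.herm]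
  · simp [smul_smul, hsq, h.sq]
  · simp only [Matrix.smul_mul, Matrix.mul_smul, h.mul01, smul_smul]
    congr 1
    linear_combination Complex.I * e 2 * hp - Complex.I * e 0 * e 1 * hsq 2
  · simp only [Matrix.smul_mul, Matrix.mul_smul, h.mul12, smul_smul]
    congr 1
    linear_combination Complex.I * e 0 * hp - Complex.I * e 1 * e 2 * hsq 0
  · simp only [Matrix.smul_mul, Matrix.mul_smul, h.mul20, smul_smul]
    congr 1
    linear_combination Complex.I * e 1 * hp - Complex.I * e 0 * e 2 * hsq 1
  · simp [h.trace]
  · rw [h.expand X]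
    congr 1
    refine Finset.sum_congr rfl fun i _ => ?_
    simp only [Matrix.smul_mul, Matrix.trace_smul, smul_smul, smul_eq_mul]
    congr 1
    linear_combination -(V i * X).trace * hsq i

end IsPauliTriple

/-- The map `X ↦ (Tr X • D + ∑ i, d i Tr (V i X) • W i) / 2`. -/
noncomputable def blochMap (V W : Fin 3 → Matrix (Fin 2) (Fin 2) ℂ) (D : Matrix (Fin 2) (Fin 2) ℂ)
    (d : Fin 3 → ℂ) : Matrix (Fin 2) (Fin 2) ℂ →ₗ[ℂ] Matrix (Fin 2) (Fin 2) ℂ where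
  toFun X := (1 / 2 : ℂ) • (X.trace • D + ∑ i, (d i * (V i * X).trace) • W i)
  map_add' X Y := by
    simp only [Matrix.trace_add, add_smul, mul_add, Finset.sum_add_distrib,
      smul_add]
    abel
  map_smul' r X := by
    simp only [Matrix.trace_smul, Matrix.mul_smul, smul_eq_mul, RingHom.id_apply, smul_add,
      smul_smul, Finset.smul_sum]
    congr 1
    · congr 1; ring
    · refine Finset.sum_congr rfl fun i _ => ?_
      congr 1; ring

theorem blochMap_apply (V W : Fin 3 → Matrix (Fin 2) (Fin 2) ℂ) (D : Matrix (Fin 2) (Fin 2) ℂ)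
    (d : Fin 3 → ℂ) (X : Matrix (Fin 2) (Fin 2) ℂ) :
    blochMap V W D d X = (1 / 2 : ℂ) • (X.trace • D + ∑ i, (d i * (V i * X).trace) • W i) := rfl

theorem blochMap_signed (V W : Fin 3 → Matrix (Fin 2) (Fin 2) ℂ) (D : Matrix (Fin 2) (Fin 2) ℂ)
    (e : Fin 3 → ℂ) : blochMap V W D e = blochMap V (fun i => e i • W i) D 1 := by
  ext1 X
  simp [blochMap_apply, smul_smul, mul_comm]

/-- The flip keeps the trace and reverses Bloch vectors. It thereby changes the sign of the product
of the three coefficients. -/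
theorem blochMap_comp_spinFlip {V : Fin 3 → Matrix (Fin 2) (Fin 2) ℂ} (hV : ∀ i, (V i).trace = 0)
    (W : Fin 3 → Matrix (Fin 2) (Fin 2) ℂ) (D : Matrix (Fin 2) (Fin 2) ℂ) (d : Fin 3 → ℂ) :
    blochMap V W D d ∘ₗ spinFlip = blochMap V W D (-d) := by
  ext1 X
  rw [LinearMap.comp_apply, blochMap_apply, blochMap_apply, trace_spinFlip]
  simp [spinFlip_apply, Matrix.mul_sub, hV]

theorem choi_blochMap (V W : Fin 3 → Matrix (Fin 2) (Fin 2) ℂ) (D : Matrix (Fin 2) (Fin 2) ℂ)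
    (d : Fin 3 → ℂ) : choi (blochMap V W D d) =
      (1 / 2 : ℂ) • ((1 : Matrix (Fin 2) (Fin 2) ℂ) ⊗ₖ D +
        ∑ i, d i • ((V i).transpose ⊗ₖ W i)) := by
  ext ⟨i, p⟩ ⟨j, q⟩
  have h1 : (Matrix.single i j (1 : ℂ)).trace = (1 : Matrix (Fin 2) (Fin 2) ℂ) i j := by
    fin_cases i <;> fin_cases j <;> simp
  have h2 : ∀ k, (V k * Matrix.single i j (1 : ℂ)).trace = V k j i := fun k => by
    rw [Matrix.trace_mul_single]; simp
  simp [choi, blochMap_apply, h1, h2, Matrix.sum_apply, mul_assoc]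

section ChoiAlgebra

variable {V W : Fin 3 → Matrix (Fin 2) (Fin 2) ℂ}

theorem choi_blochMap_one (V W : Fin 3 → Matrix (Fin 2) (Fin 2) ℂ) :
    choi (blochMap V W 1 1) = (1 / 2 : ℂ) • (1 + (V 0).transpose ⊗ₖ W 0 +
      (V 1).transpose ⊗ₖ W 1 + (V 2).transpose ⊗ₖ W 2) := by
  simp [choi_blochMap, Fin.sum_univ_three, add_assoc]

theorem choi_isHermitian (hV : IsPauliTriple V) (hW : IsPauliTriple W) :
    (choi (blochMap V W 1 1)).conjTranspose = choi (blochMap V W 1 1) := by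
  have h : ∀ i, (V i).transpose.conjTranspose = (V i).transpose := fun i => by
    change (V i).conjTranspose.transpose = _
    rw [hV.herm]
  simp [choi_blochMap_one, Matrix.conjTranspose_kronecker, h, hW.herm]

/-- Sandwiching a local operator between maximally entangled projectors gives its trace. -/
theorem choi_mul_kronecker_mul_choi (hV : IsPauliTriple V) (hW : IsPauliTriple W)
    (X : Matrix (Fin 2) (Fin 2) ℂ) :
    choi (blochMap V W 1 1) * ((1 : Matrix (Fin 2) (Fin 2) ℂ) ⊗ₖ X) * choi (blochMap V W 1 1) =
      X.trace • choi (blochMap V W 1 1) := by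
  -- Transposition reverses the orientation of `V`, so the factors `±I` cancel against those of `W`:
  -- the operators `1` and `(V i)ᵀ ⊗ₖ W i` form a Klein four-group. The Choi matrix is half their
  -- sum, hence twice a projection.
  have t : ∀ i j, (V i).transpose * (V j).transpose = (V j * V i).transpose := fun i j =>
    (Matrix.transpose_mul _ _).symm
  have h1 : choi (blochMap V W 1 1) * choi (blochMap V W 1 1) =
      (2 : ℂ) • choi (blochMap V W 1 1) := by
    simp only [choi_blochMap_one, Matrix.smul_mul, Matrix.mul_smul, mul_add, add_mul, one_mul,
      mul_one, ← Matrix.mul_kronecker_mul, t, hV.sq, hV.mul01, hV.mul12, hV.mul20, hV.mul10,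
      hV.mul21, hV.mul02, hW.sq, hW.mul01, hW.mul12, hW.mul20, hW.mul10, hW.mul21, hW.mul02,
      Matrix.transpose_smul, Matrix.smul_kronecker, Matrix.kronecker_smul, smul_smul,
      Matrix.transpose_one, Matrix.one_kronecker_one]
    simp
    module
  -- Moving `1 ⊗ₖ W i` across the Choi matrix changes the sign of two group elements, which yields
  -- an orthogonal projection.
  have h2 : ∀ i, choi (blochMap V W 1 1) * ((1 : Matrix (Fin 2) (Fin 2) ℂ) ⊗ₖ W i) *
      choi (blochMap V W 1 1) = 0 := by
    intro i
    fin_cases i <;>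
    · simp only [choi_blochMap_one, Matrix.smul_mul, Matrix.mul_smul, mul_add, add_mul, one_mul,
        mul_one, ← Matrix.mul_kronecker_mul, t, hV.sq, hV.mul01, hV.mul12, hV.mul20, hV.mul10,
        hV.mul21, hV.mul02, hW.sq, hW.mul01, hW.mul12, hW.mul20, hW.mul10, hW.mul21, hW.mul02,
        Matrix.transpose_smul, Matrix.smul_kronecker, Matrix.kronecker_smul, smul_smul,
        Matrix.transpose_one, Fin.zero_eta, Fin.mk_one, Fin.reduceFinMk]
      simp
      module
  have h3 : (2 : ℂ) • (choi (blochMap V W 1 1) * ((1 : Matrix (Fin 2) (Fin 2) ℂ) ⊗ₖ X) *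
      choi (blochMap V W 1 1)) = (2 : ℂ) • (X.trace • choi (blochMap V W 1 1)) := by
    rw [← Matrix.smul_mul, ← Matrix.mul_smul, ← Matrix.kronecker_smul, hW.expand X]
    simp only [Fin.sum_univ_three, Matrix.kronecker_add, Matrix.kronecker_smul, Matrix.mul_add,
      Matrix.add_mul, Matrix.mul_smul, Matrix.smul_mul, h2, Matrix.one_kronecker_one, mul_one, h1]
    module
  exact smul_right_injective _ (two_ne_zero' ℂ) h3

theorem choi_mul_self (hV : IsPauliTriple V) (hW : IsPauliTriple W) :
    choi (blochMap V W 1 1) * choi (blochMap V W 1 1) = (2 : ℂ) • choi (blochMap V W 1 1) := by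
  simpa using choi_mul_kronecker_mul_choi hV hW 1

theorem posSemidef_choi (hV : IsPauliTriple V) (hW : IsPauliTriple W) :
    (choi (blochMap V W 1 1)).PosSemidef := by
  have h := (Matrix.posSemidef_conjTranspose_mul_self (choi (blochMap V W 1 1))).smul
    (show (0 : ℂ) ≤ 1 / 2 by norm_num [Complex.le_def])
  rw [choi_isHermitian hV hW, choi_mul_self hV hW, smul_smul] at h
  simpa using h

/-- Subtracting a multiple of a rank-one projection from an invertible `P` is governed by `P⁻¹` on
its range. Here `P⁻¹` is `A / q`, and sandwiching `A` gives `Tr Y`, so the condition becomes `s * Tr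
Y ≤ det Y`. -/
theorem posSemidef_kronecker_sub_choi (hV : IsPauliTriple V) (hW : IsPauliTriple W)
    {Y : Matrix (Fin 2) (Fin 2) ℂ} (hY : Y.PosSemidef) {s q : ℝ} (hs : 0 ≤ s)
    (hq : Y.det = q) (htr : Y.trace = 2 * (s + 1)) (hsq : 2 * s * (s + 1) ≤ q) :
    ((1 : Matrix (Fin 2) (Fin 2) ℂ) ⊗ₖ Y - (s : ℂ) • choi (blochMap V W 1 1)).PosSemidef := by
  -- For `s = 0` the determinant `q` may vanish and cannot be divided by.
  rcases hs.eq_or_lt with rfl | hs'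
  · simpa using Matrix.PosSemidef.one.kronecker hY
  have hq0 : 0 < q := lt_of_lt_of_le (by positivity) hsq
  set C := choi (blochMap V W 1 1) with hC
  set P := (1 : Matrix (Fin 2) (Fin 2) ℂ) ⊗ₖ Y with hP
  set A := (1 : Matrix (Fin 2) (Fin 2) ℂ) ⊗ₖ spinFlip Y with hA
  have hPA : P * A = (q : ℂ) • 1 := by
    rw [hP, hA, ← Matrix.mul_kronecker_mul, spinFlip_eq_adjugate, Matrix.mul_adjugate, hq]
    simp [Matrix.kronecker_smul]
  have hAP : A * P = (q : ℂ) • 1 := by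
    rw [hP, hA, ← Matrix.mul_kronecker_mul, spinFlip_eq_adjugate, Matrix.adjugate_mul, hq]
    simp [Matrix.kronecker_smul]
  have hCAC : C * A * C = (2 * (s + 1) : ℂ) • C := by
    rw [hC, hA, choi_mul_kronecker_mul_choi hV hW, trace_spinFlip, htr]
  have hG : (P - (s : ℂ) • C).conjTranspose = P - (s : ℂ) • C := by
    rw [Matrix.conjTranspose_sub, Matrix.conjTranspose_smul, hC, choi_isHermitian hV hW, hP,
      Matrix.conjTranspose_kronecker, hY.isHermitian.eq]
    simp
  have hA0 : A.PosSemidef := Matrix.PosSemidef.one.kronecker (posSemidef_spinFlip hY)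
  -- Both terms on the left are positive, which exhibits `q • (P - s • C)` as positive.
  have key : (P - (s : ℂ) • C) * A * (P - (s : ℂ) • C) +
      ((s * (q - 2 * s * (s + 1)) : ℝ) : ℂ) • C = (q : ℂ) • (P - (s : ℂ) • C) := by
    have h1 : C * A * P = (q : ℂ) • C := by rw [mul_assoc, hAP]; simp
    simp only [sub_mul, mul_sub, hPA, Matrix.smul_mul, Matrix.mul_smul, hCAC, h1, one_mul]
    push_cast
    module
  have h2 := hA0.mul_mul_conjTranspose_same (P - (s : ℂ) • C)
  rw [hG] at h2
  have h3 := h2.add ((posSemidef_choi hV hW).smul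
    (show (0 : ℂ) ≤ ((s * (q - 2 * s * (s + 1)) : ℝ) : ℂ) by
      exact_mod_cast mul_nonneg hs (by linarith)))
  rw [← hC, key] at h3
  have h4 := h3.smul (show (0 : ℂ) ≤ ((q⁻¹ : ℝ) : ℂ) by exact_mod_cast (inv_pos.2 hq0).le)
  rw [smul_smul, ← Complex.ofReal_mul, inv_mul_cancel₀ hq0.ne'] at h4
  simpa using h4

end ChoiAlgebra

end Pauli

/-! ### Singular value decomposition. -/

section SingularValues

/-- Singular value decomposition of a linear endomorphism of a Euclidean space. -/
theorem exists_orthonormalBasis_singular {n : ℕ}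
    (T : EuclideanSpace ℝ (Fin n) →ₗ[ℝ] EuclideanSpace ℝ (Fin n)) :
    ∃ (v w : OrthonormalBasis (Fin n) ℝ (EuclideanSpace ℝ (Fin n))) (a : Fin n → ℝ),
      (∀ i, 0 ≤ a i) ∧ ∀ i, T (v i) = a i • w i := by
  have hS : (T.adjoint ∘ₗ T).IsSymmetric := (LinearMap.isPositive_adjoint_comp_self T).isSymmetric
  have hn : Module.finrank ℝ (EuclideanSpace ℝ (Fin n)) = n := by simp
  set v := hS.eigenvectorBasis hn with hv
  have horth : ∀ i j, i ≠ j → inner ℝ (T (v i)) (T (v j)) = 0 := fun i j hij => by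
    have h1 : inner ℝ (v i) ((T.adjoint ∘ₗ T) (v j)) = inner ℝ (T (v i)) (T (v j)) := by
      rw [LinearMap.comp_apply, LinearMap.adjoint_inner_right]
    rw [← h1, hv, hS.apply_eigenvectorBasis, inner_smul_right, ← hv,
      v.orthonormal.inner_eq_zero hij, mul_zero]
  let u : Fin n → EuclideanSpace ℝ (Fin n) := fun i => ‖T (v i)‖⁻¹ • T (v i)
  -- Only nonzero images have a direction; the remaining basis vectors are arbitrary, as their
  -- singular value is zero.
  let s : Set (Fin n) := {i | T (v i) ≠ 0}
  have hu : Orthonormal ℝ (s.domRestrict u) := by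
    refine ⟨fun i => ?_, fun i j hij => ?_⟩
    · have : ‖T (v i)‖ ≠ 0 := norm_ne_zero_iff.2 i.2
      simp [u, norm_smul, this]
    · have : (i : Fin n) ≠ j := fun h => hij (Subtype.ext h)
      simp [u, inner_smul_left, inner_smul_right, horth _ _ this]
  obtain ⟨w, hw⟩ := hu.exists_orthonormalBasis_extension_of_card_eq (by simp)
  refine ⟨v, w, fun i => ‖T (v i)‖, fun i => norm_nonneg _, fun i => ?_⟩
  by_cases hi : T (v i) = 0
  · simp [hi]
  · rw [hw i hi]
    simp [u, smul_smul, norm_ne_zero_iff.2 hi]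

end SingularValues

/-! ### Bloch vectors and Pauli triples from orthonormal bases. -/

section PauliVectors

/-- The observable `x · σ` of a Bloch vector `x`. -/
noncomputable def pauliVec : EuclideanSpace ℝ (Fin 3) →ₗ[ℝ] Matrix (Fin 2) (Fin 2) ℂ where
  toFun x := !![(x 2 : ℂ), x 0 - Complex.I * x 1; x 0 + Complex.I * x 1, -x 2]
  map_add' x y := by
    ext i j
    fin_cases i <;> fin_cases j <;> simp <;> ring
  map_smul' r x := by
    ext i j
    fin_cases i <;> fin_cases j <;> simp <;> ring

theorem pauliVec_apply (x : EuclideanSpace ℝ (Fin 3)) :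
    pauliVec x = !![(x 2 : ℂ), x 0 - Complex.I * x 1; x 0 + Complex.I * x 1, -x 2] := rfl

theorem pauliVec_conjTranspose (x : EuclideanSpace ℝ (Fin 3)) :
    (pauliVec x).conjTranspose = pauliVec x := by
  ext i j
  fin_cases i <;> fin_cases j <;> simp [pauliVec_apply, sub_eq_add_neg]

theorem trace_pauliVec (x : EuclideanSpace ℝ (Fin 3)) : (pauliVec x).trace = 0 := by
  simp [pauliVec_apply, Matrix.trace_fin_two]

/-- The vector `z` is the cross product, given by coordinates so that it can be supplied directly as
a multiple of a basis vector. -/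
theorem pauliVec_mul (x y z : EuclideanSpace ℝ (Fin 3)) (h0 : x 1 * y 2 - x 2 * y 1 = z 0)
    (h1 : x 2 * y 0 - x 0 * y 2 = z 1) (h2 : x 0 * y 1 - x 1 * y 0 = z 2) :
    pauliVec x * pauliVec y =
      ((inner ℝ x y : ℝ) : ℂ) • (1 : Matrix (Fin 2) (Fin 2) ℂ) + Complex.I • pauliVec z := by
  have hI := Complex.I_mul_I
  ext i j
  fin_cases i <;> fin_cases j <;>
    simp [pauliVec_apply, Matrix.mul_apply, Fin.sum_univ_two, PiLp.inner_apply,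
      Fin.sum_univ_three, ← h0, ← h1, ← h2]
  · linear_combination (-(x 1 : ℂ) * y 1) * hI
  · linear_combination ((x 2 : ℂ) * y 0 - x 0 * y 2) * hI
  · linear_combination (-(x 2 : ℂ) * y 0 + x 0 * y 2) * hI
  · linear_combination (-(x 1 : ℂ) * y 1) * hI

theorem trace_pauliVec_mul (x y : EuclideanSpace ℝ (Fin 3)) :
    (pauliVec x * pauliVec y).trace = 2 * ((inner ℝ x y : ℝ) : ℂ) := by
  rw [pauliVec_mul x y (WithLp.toLp 2 ![x 1 * y 2 - x 2 * y 1, x 2 * y 0 - x 0 * y 2,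
    x 0 * y 1 - x 1 * y 0]) rfl rfl rfl]
  simp [trace_pauliVec, mul_comm]

/-- Traceless Hermitian qubit operators are given by Bloch vectors. -/
theorem exists_eq_pauliVec {H : Matrix (Fin 2) (Fin 2) ℂ} (hH : H.IsHermitian)
    (ht : H.trace = 0) : ∃ x, H = pauliVec x := by
  have h00 := congrArg Complex.im (congrFun (congrFun hH.eq 0) 0)
  have h01 := congrFun (congrFun hH.eq 0) 1
  rw [Matrix.trace_fin_two] at ht
  have h11 : H 1 1 = -H 0 0 := by linear_combination ht
  simp at h00 h01
  have him : (H 0 0).im = 0 := by linarith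
  refine ⟨WithLp.toLp 2 ![(H 1 0).re, (H 1 0).im, (H 0 0).re], ?_⟩
  ext i j
  fin_cases i <;> fin_cases j
  · apply Complex.ext <;> simp [pauliVec_apply, him]
  · simp only [pauliVec_apply]
    simp [← h01]
    apply Complex.ext <;> simp
  · simp only [pauliVec_apply]
    apply Complex.ext <;> simp
  · apply Complex.ext <;> simp [pauliVec_apply, him, h11]

theorem eq_smul_one_add_pauliVec (X : Matrix (Fin 2) (Fin 2) ℂ) :
    ∃ (r : ℂ) (x : Fin 3 → ℂ), X = r • (1 : Matrix (Fin 2) (Fin 2) ℂ) +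
      ∑ j, x j • pauliVec (EuclideanSpace.single j 1) := by
  refine ⟨(X 0 0 + X 1 1) / 2, ![(X 0 1 + X 1 0) / 2, Complex.I * (X 0 1 - X 1 0) / 2,
    (X 0 0 - X 1 1) / 2], ?_⟩
  have hI := Complex.I_mul_I
  ext i j
  fin_cases i <;> fin_cases j <;> simp [Fin.sum_univ_three, pauliVec_apply]
  · ring
  · linear_combination ((X 0 1 - X 1 0) / 2) * hI
  · linear_combination (-(X 0 1 - X 1 0) / 2) * hI
  · ring

/-- Up to a common sign, an orthonormal basis of Bloch vectors gives a Pauli triple. -/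
theorem exists_sign_isPauliTriple (b : OrthonormalBasis (Fin 3) ℝ (EuclideanSpace ℝ (Fin 3))) :
    ∃ η : ℝ, (η = 1 ∨ η = -1) ∧ IsPauliTriple fun i => (η : ℂ) • pauliVec (b i) := by
  let Q : Matrix (Fin 3) (Fin 3) ℝ := Matrix.of fun i j => b i j
  have hin : ∀ i j, inner ℝ (b i) (b j) = if i = j then (1 : ℝ) else 0 :=
    orthonormal_iff_ite.1 b.orthonormal
  have hQ : Q * Q.transpose = 1 := by
    ext i j
    have := hin i j
    rw [PiLp.inner_apply] at this
    simp only [Matrix.mul_apply, Matrix.transpose_apply, Matrix.one_apply, Q, Matrix.of_apply]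
    rw [← this]
    exact Finset.sum_congr rfl fun k _ => by simp [mul_comm]
  have hdet : Q.det * Q.det = 1 := by
    have := congrArg Matrix.det hQ
    simpa using this
  -- The entries of the adjugate are those of cross products of the rows, so `b i × b j = η • b k`
  -- for cyclic indices, with `η = det Q`.
  have hadj : Q.adjugate = Q.det • Q.transpose := by
    calc Q.adjugate = Q.adjugate * (Q * Q.transpose) := by rw [hQ, mul_one]
      _ = _ := by rw [← mul_assoc, Matrix.adjugate_mul]; simp
  have hent : ∀ i j, Q.adjugate i j = Q.det * b j i := fun i j => by rw [hadj]; simp [Q]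
  simp only [Matrix.adjugate_fin_three] at hent
  have h02 := hent 0 2
  have h12 := hent 1 2
  have h22 := hent 2 2
  have h00 := hent 0 0
  have h10 := hent 1 0
  have h20 := hent 2 0
  have h01 := hent 0 1
  have h11 := hent 1 1
  have h21 := hent 2 1
  simp [Q] at h02 h12 h22 h00 h10 h20 h01 h11 h21
  have hη := mul_self_eq_one_iff.1 hdet
  generalize Q.det = η at *
  have hηC : (η : ℂ) * η = 1 := by exact_mod_cast hdet
  have hmul : ∀ i j k, inner ℝ (b i) (b j) = 0 →
      b i 1 * b j 2 - b i 2 * b j 1 = η * b k 0 → b i 2 * b j 0 - b i 0 * b j 2 = η * b k 1 →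
      b i 0 * b j 1 - b i 1 * b j 0 = η * b k 2 →
      ((η : ℂ) • pauliVec (b i)) * ((η : ℂ) • pauliVec (b j)) =
        Complex.I • (η : ℂ) • pauliVec (b k) := by
    intro i j k hij h0 h1 h2
    have hz : pauliVec (η • b k) = (η : ℂ) • pauliVec (b k) := by
      rw [map_smul]; rfl
    rw [Matrix.smul_mul, Matrix.mul_smul, smul_smul, hηC, one_smul,
      pauliVec_mul (b i) (b j) (η • b k) h0 h1 h2, hij, hz]
    simp
  refine ⟨η, hη, fun i => ?_, fun i => ?_, ?_, ?_, ?_, fun i => ?_, fun X => ?_⟩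
  · simp [pauliVec_conjTranspose]
  · rw [Matrix.smul_mul, Matrix.mul_smul, smul_smul, hηC, one_smul,
      pauliVec_mul (b i) (b i) 0 (by simp; ring) (by simp; ring) (by simp; ring), hin]
    simp
  · exact hmul 0 1 2 (by simp [hin]) (by linarith) (by linarith) (by linarith)
  · exact hmul 1 2 0 (by simp [hin]) (by linarith) (by linarith) (by linarith)
  · exact hmul 2 0 1 (by simp [hin]) (by linarith) (by linarith) (by linarith)
  · simp [trace_pauliVec]
  · have hvec : ∀ x, (2 : ℂ) • pauliVec x = (pauliVec x).trace • (1 : Matrix (Fin 2) (Fin 2) ℂ) +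
        ∑ i, (((η : ℂ) • pauliVec (b i)) * pauliVec x).trace • ((η : ℂ) • pauliVec (b i)) := by
      intro x
      conv_lhs => rw [← b.sum_repr' x]
      rw [trace_pauliVec, map_sum, Finset.smul_sum, zero_smul, zero_add]
      refine Finset.sum_congr rfl fun i _ => ?_
      rw [Matrix.smul_mul, Matrix.trace_smul, trace_pauliVec_mul, map_smul, smul_smul, smul_eq_mul]
      change (2 : ℂ) • ((inner ℝ (b i) x : ℝ) : ℂ) • pauliVec (b i) = _
      rw [smul_smul]
      congr 1
      linear_combination (-2 * ((inner ℝ (b i) x : ℝ) : ℂ)) * hηC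
    obtain ⟨r, x, rfl⟩ := eq_smul_one_add_pauliVec X
    simp only [smul_add, smul_comm (2 : ℂ), hvec, Fin.sum_univ_three,
      Matrix.trace_add, Matrix.trace_smul, Matrix.mul_add, Matrix.mul_smul, mul_one,
      trace_pauliVec, Matrix.trace_one, smul_eq_mul, Fintype.card_fin]
    push_cast
    module

end PauliVectors

/-! ### Singular form of a channel and its flip decomposition. -/

section Decomposition

/-- Reflections give positive operators `1 + P`. -/
theorem posSemidef_one_add {n : Type*} [Fintype n] [DecidableEq n] {P : Matrix n n ℂ}
    (hP : P.conjTranspose = P) (h : P * P = 1) : (1 + P).PosSemidef := by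
  have h1 := (Matrix.posSemidef_conjTranspose_mul_self (1 + P)).smul
    (show (0 : ℂ) ≤ 1 / 2 by norm_num [Complex.le_def])
  convert h1 using 1
  simp only [Matrix.conjTranspose_add, Matrix.conjTranspose_one, hP, add_mul, mul_add, one_mul,
    mul_one, h]
  module

/-- The singular value form of a qubit channel on Bloch vectors. -/
theorem exists_eq_blochMap (M : Channel (Fin 2) (Fin 2)) :
    ∃ (V W : Fin 3 → Matrix (Fin 2) (Fin 2) ℂ) (d : Fin 3 → ℝ) (s : ℝ),
      IsPauliTriple V ∧ IsPauliTriple W ∧ 0 ≤ s ∧ (∀ i, |d i| ≤ s) ∧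
      (∃ j, ∃ ζ : ℝ, (ζ = 1 ∨ ζ = -1) ∧ d j = ζ * s) ∧
      M.toLinearMap = blochMap V W (M.toLinearMap 1) (fun i => (d i : ℂ)) := by
  -- The image is traceless, and Hermitian as the difference of the images of the positive operators
  -- `1 + σ` and `1`.
  have hex : ∀ j : Fin 3, ∃ t, M.toLinearMap (pauliVec (EuclideanSpace.single j 1)) =
      pauliVec t := by
    intro j
    have hsq : pauliVec (EuclideanSpace.single j 1) * pauliVec (EuclideanSpace.single j 1) = 1 := by
      rw [pauliVec_mul _ _ 0 (sub_eq_zero.2 (mul_comm _ _)) (sub_eq_zero.2 (mul_comm _ _))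
        (sub_eq_zero.2 (mul_comm _ _))]
      simp
    have h1 := (M.completelyPositive.posSemidef_apply
      (posSemidef_one_add (pauliVec_conjTranspose _) hsq)).isHermitian
    have h2 := (M.completelyPositive.posSemidef_apply
      (Matrix.PosSemidef.one (n := Fin 2) (R := ℂ))).isHermitian
    have h3 := h1.sub h2
    rw [map_add, add_sub_cancel_left] at h3
    exact exists_eq_pauliVec h3 (by rw [M.tracePreserving, trace_pauliVec])
  choose t ht using hex
  let B := (EuclideanSpace.basisFun (Fin 3) ℝ).toBasis
  let T : EuclideanSpace ℝ (Fin 3) →ₗ[ℝ] EuclideanSpace ℝ (Fin 3) := B.constr ℝ t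
  have hT : ∀ x, M.toLinearMap (pauliVec x) = pauliVec (T x) := by
    have : M.toLinearMap.restrictScalars ℝ ∘ₗ pauliVec = pauliVec ∘ₗ T := by
      refine B.ext fun i => ?_
      have hTi : T (B i) = t i := B.constr_basis ℝ t i
      rw [LinearMap.comp_apply, LinearMap.comp_apply, hTi]
      simpa [B] using ht i
    exact fun x => LinearMap.congr_fun this x
  obtain ⟨v, w, a, ha, hTv⟩ := exists_orthonormalBasis_singular T
  obtain ⟨η, hη, hV⟩ := exists_sign_isPauliTriple v
  obtain ⟨θ, hθ, hW⟩ := exists_sign_isPauliTriple w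
  obtain ⟨j, hj⟩ := Finite.exists_max a
  -- Orienting the two bases costs one common sign, so the coefficients are the singular values up
  -- to this sign.
  have hsign : η * θ = 1 ∨ η * θ = -1 := by
    rcases hη with rfl | rfl <;> rcases hθ with rfl | rfl <;> simp
  have hθ2 : (θ : ℂ) * θ = 1 := by rcases hθ with rfl | rfl <;> simp
  refine ⟨_, _, fun i => η * θ * a i, a j, hV, hW, ha j, fun i => ?_, ⟨j, η * θ, hsign, rfl⟩, ?_⟩
  · rw [abs_mul, abs_of_nonneg (ha i)]
    rcases hsign with h | h <;> rw [h] <;> simpa using hj i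
  · have hMV : ∀ i, M.toLinearMap ((η : ℂ) • pauliVec (v i)) =
        ((η * θ * a i : ℝ) : ℂ) • (θ : ℂ) • pauliVec (w i) := fun i => by
      rw [map_smul, hT, hTv, map_smul]
      change (η : ℂ) • (a i : ℂ) • pauliVec (w i) = _
      rw [smul_smul, smul_smul]
      congr 1
      push_cast
      linear_combination (-(η : ℂ) * a i) * hθ2
    ext1 X
    have h := congrArg M.toLinearMap (hV.expand X)
    rw [map_smul, map_add, map_smul, map_sum] at h
    rw [blochMap_apply, eq_comm, one_div, inv_smul_eq_iff₀ two_ne_zero, h]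
    congr 1
    refine Finset.sum_congr rfl fun i _ => ?_
    rw [map_smul, hMV, smul_smul, smul_smul, smul_smul]
    congr 1
    ring

/-- The map `X ↦ Tr X • Z`. -/
noncomputable def traceMap (Z : Matrix (Fin 2) (Fin 2) ℂ) :
    Matrix (Fin 2) (Fin 2) ℂ →ₗ[ℂ] Matrix (Fin 2) (Fin 2) ℂ :=
  (Matrix.traceLinearMap (Fin 2) ℂ ℂ).smulRight Z

theorem traceMap_apply (Z X : Matrix (Fin 2) (Fin 2) ℂ) : traceMap Z X = X.trace • Z := rfl

theorem choi_traceMap (Z : Matrix (Fin 2) (Fin 2) ℂ) :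
    choi (traceMap Z) = (1 : Matrix (Fin 2) (Fin 2) ℂ) ⊗ₖ Z := by
  ext ⟨i, p⟩ ⟨j, q⟩
  have h1 : (Matrix.single i j (1 : ℂ)).trace = (1 : Matrix (Fin 2) (Fin 2) ℂ) i j := by
    fin_cases i <;> fin_cases j <;> simp
  simp [choi, traceMap_apply, h1]

/-- Maps `K + L ∘ spinFlip` with `K` and `L` completely positive and `L` dominated by
`X ↦ Tr X • Y`. -/
def IsFlipDecomposable (Y : Matrix (Fin 2) (Fin 2) ℂ)
    (Φ : Matrix (Fin 2) (Fin 2) ℂ →ₗ[ℂ] Matrix (Fin 2) (Fin 2) ℂ) : Prop :=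
  ∃ K L : Matrix (Fin 2) (Fin 2) ℂ →ₗ[ℂ] Matrix (Fin 2) (Fin 2) ℂ, IsCompletelyPositive K ∧
    IsCompletelyPositive L ∧ IsCompletelyPositive (traceMap Y - L) ∧ Φ = K + L ∘ₗ spinFlip

/-- For fixed `Y` the decomposable maps form a convex set, which reduces the cube of coefficients to
its vertices. -/
theorem IsFlipDecomposable.combination {Y : Matrix (Fin 2) (Fin 2) ℂ}
    {Φ Ψ : Matrix (Fin 2) (Fin 2) ℂ →ₗ[ℂ] Matrix (Fin 2) (Fin 2) ℂ}
    (hΦ : IsFlipDecomposable Y Φ) (hΨ : IsFlipDecomposable Y Ψ) {p q : ℂ} (hp : 0 ≤ p)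
    (hq : 0 ≤ q) (hpq : p + q = 1) : IsFlipDecomposable Y (p • Φ + q • Ψ) := by
  obtain ⟨K, L, hK, hL, hYL, rfl⟩ := hΦ
  obtain ⟨K', L', hK', hL', hYL', rfl⟩ := hΨ
  refine ⟨p • K + q • K', p • L + q • L', (hK.smul hp).add (hK'.smul hq),
    (hL.smul hp).add (hL'.smul hq), ?_, ?_⟩
  · convert (hYL.smul hp).add (hYL'.smul hq) using 1
    rw [smul_sub, smul_sub, sub_add_sub_comm, ← add_smul, hpq, one_smul]
  · rw [LinearMap.add_comp, LinearMap.smul_comp, LinearMap.smul_comp]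
    module

section Cube

variable {V W : Fin 3 → Matrix (Fin 2) (Fin 2) ℂ} {Y : Matrix (Fin 2) (Fin 2) ℂ} {s q : ℝ}

theorem isCompletelyPositive_blochMap (hV : IsPauliTriple V) (hW : IsPauliTriple W)
    {e : Fin 3 → ℂ} (he : ∀ i, e i = 1 ∨ e i = -1) (hp : e 0 * e 1 * e 2 = 1) :
    IsCompletelyPositive (blochMap V W 1 e) := by
  rw [blochMap_signed]
  exact isCompletelyPositive_of_choi (posSemidef_choi hV (hW.signed he hp))

theorem choi_sub_smul (Φ Ψ : Matrix (Fin 2) (Fin 2) ℂ →ₗ[ℂ] Matrix (Fin 2) (Fin 2) ℂ) (r : ℂ) :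
    choi (Φ - r • Ψ) = choi Φ - r • choi Ψ := rfl

theorem isCompletelyPositive_traceMap_sub (hV : IsPauliTriple V) (hW : IsPauliTriple W)
    {e : Fin 3 → ℂ} (he : ∀ i, e i = 1 ∨ e i = -1) (hp : e 0 * e 1 * e 2 = 1)
    (hY : Y.PosSemidef) (hs : 0 ≤ s) (hq : Y.det = q) (htr : Y.trace = 2 * (s + 1))
    (hsq : 2 * s * (s + 1) ≤ q) :
    IsCompletelyPositive (traceMap Y - (s : ℂ) • blochMap V W 1 e) := by
  rw [blochMap_signed]
  apply isCompletelyPositive_of_choi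
  rw [choi_sub_smul, choi_traceMap]
  exact posSemidef_kronecker_sub_choi hV (hW.signed he hp) hY hs hq htr hsq

/-- Signs with product `1` give a completely positive map, used as `K`. Otherwise the opposite signs
have product `1`, and the map is a completely positive `L` after the flip. -/
theorem isFlipDecomposable_vertex (hV : IsPauliTriple V) (hW : IsPauliTriple W)
    {e : Fin 3 → ℂ} (he : ∀ i, e i = 1 ∨ e i = -1)
    (hY : Y.PosSemidef) (hs : 0 ≤ s) (hq : Y.det = q) (htr : Y.trace = 2 * (s + 1))
    (hsq : 2 * s * (s + 1) ≤ q) :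
    IsFlipDecomposable Y ((s : ℂ) • blochMap V W 1 e) := by
  have hsC : (0 : ℂ) ≤ s := by exact_mod_cast hs
  have hprod : e 0 * e 1 * e 2 = 1 ∨ (-e) 0 * (-e) 1 * (-e) 2 = 1 := by
    rcases he 0 with h0 | h0 <;> rcases he 1 with h1 | h1 <;> rcases he 2 with h2 | h2 <;>
      simp [h0, h1, h2]
  rcases hprod with hp | hp
  · refine ⟨_, 0, (isCompletelyPositive_blochMap hV hW he hp).smul hsC,
      IsCompletelyPositive.zero, ?_, by simp⟩
    apply isCompletelyPositive_of_choi
    rw [sub_zero, choi_traceMap]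
    exact Matrix.PosSemidef.one.kronecker hY
  · have he' : ∀ i, (-e) i = 1 ∨ (-e) i = -1 := fun i => by
      rcases he i with h | h <;> simp [h]
    refine ⟨0, _, IsCompletelyPositive.zero,
      (isCompletelyPositive_blochMap hV hW he' hp).smul hsC,
      isCompletelyPositive_traceMap_sub hV hW he' hp hY hs hq htr hsq, ?_⟩
    rw [LinearMap.smul_comp, blochMap_comp_spinFlip hV.trace, neg_neg, zero_add]

theorem blochMap_interpolate (D : Matrix (Fin 2) (Fin 2) ℂ) (f g : Fin 3 → ℂ) {p r : ℂ}
    (h : p + r = 1) :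
    blochMap V W D (p • f + r • g) = p • blochMap V W D f + r • blochMap V W D g := by
  ext1 X
  simp only [blochMap_apply, LinearMap.add_apply, LinearMap.smul_apply, Fin.sum_univ_three,
    Pi.add_apply, Pi.smul_apply, smul_eq_mul]
  obtain rfl := eq_sub_of_add_eq h
  module

/-- The coefficients lie in the cube `[-s, s]^3`, the convex hull of its eight decomposable
vertices. -/
theorem isFlipDecomposable_blochMap (hV : IsPauliTriple V) (hW : IsPauliTriple W)
    {d : Fin 3 → ℝ} (hd : ∀ i, |d i| ≤ s)
    (hY : Y.PosSemidef) (hs : 0 ≤ s) (hq : Y.det = q) (htr : Y.trace = 2 * (s + 1))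
    (hsq : 2 * s * (s + 1) ≤ q) :
    IsFlipDecomposable Y (blochMap V W ((s : ℂ) • 1) fun i => (d i : ℂ)) := by
  have hvert : ∀ e : Fin 3 → ℂ, (∀ i, e i = 1 ∨ e i = -1) →
      IsFlipDecomposable Y (blochMap V W ((s : ℂ) • 1) ((s : ℂ) • e)) := by
    intro e he
    convert isFlipDecomposable_vertex hV hW he hY hs hq htr hsq using 1
    ext1 X
    simp only [blochMap_apply, LinearMap.smul_apply, Fin.sum_univ_three, Pi.smul_apply,
      smul_eq_mul]
    module
  -- The interpolation weights `(s ± d k) / (2 * s)` need `s ≠ 0`; for `s = 0` the cube is a point.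
  rcases hs.eq_or_lt with rfl | hs'
  · have : (fun i => (d i : ℂ)) = (((0 : ℝ) : ℂ)) • (1 : Fin 3 → ℂ) := by
      ext i
      have := abs_nonpos_iff.1 (hd i)
      simp [this]
    rw [this]
    exact hvert 1 fun i => Or.inl rfl
  have hsne : (s : ℂ) ≠ 0 := by exact_mod_cast hs'.ne'
  -- interpolate one coordinate at a time
  have step : ∀ (k : Fin 3) (f : Fin 3 → ℂ),
      IsFlipDecomposable Y (blochMap V W ((s : ℂ) • 1) (Function.update f k s)) →
      IsFlipDecomposable Y (blochMap V W ((s : ℂ) • 1) (Function.update f k (-s))) →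
      IsFlipDecomposable Y (blochMap V W ((s : ℂ) • 1) (Function.update f k (d k))) := by
    intro k f h1 h2
    obtain ⟨hl, hu⟩ := abs_le.1 (hd k)
    have h := h1.combination h2 (p := (((s + d k) / (2 * s) : ℝ) : ℂ))
      (q := (((s - d k) / (2 * s) : ℝ) : ℂ))
      (by exact_mod_cast div_nonneg (by linarith) (by linarith))
      (by exact_mod_cast div_nonneg (by linarith) (by linarith))
      (by push_cast; field_simp; ring)
    rw [← blochMap_interpolate _ _ _ (by push_cast; field_simp; ring)] at h
    convert h using 2
    ext i
    rcases eq_or_ne i k with rfl | hik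
    · simp
      field_simp
      ring
    · simp [hik]
      field_simp
      ring
  have hs_or : ∀ x y z : ℂ, (x = 1 ∨ x = -1) → (y = 1 ∨ y = -1) → (z = 1 ∨ z = -1) →
      IsFlipDecomposable Y (blochMap V W ((s : ℂ) • 1) ![s * x, s * y, s * z]) := by
    intro x y z hx hy hz
    convert hvert ![x, y, z] (fun i => by fin_cases i <;> simpa) using 2
    simp
  have l0 : ∀ x y z w : ℂ, Function.update ![x, y, z] 0 w = ![w, y, z] := by
    intro x y z w; ext i; fin_cases i <;> simp
  have l1 : ∀ x y z w : ℂ, Function.update ![x, y, z] 1 w = ![x, w, z] := by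
    intro x y z w; ext i; fin_cases i <;> simp
  have l2 : ∀ x y z w : ℂ, Function.update ![x, y, z] 2 w = ![x, y, w] := by
    intro x y z w; ext i; fin_cases i <;> simp
  have h0 : ∀ y z : ℂ, (y = 1 ∨ y = -1) → (z = 1 ∨ z = -1) →
      IsFlipDecomposable Y (blochMap V W ((s : ℂ) • 1) ![(d 0 : ℂ), s * y, s * z]) := by
    intro y z hy hz
    have := step 0 ![0, s * y, s * z]
    rw [l0, l0, l0] at this
    exact this (by simpa using hs_or 1 y z (by simp) hy hz)
      (by simpa using hs_or (-1) y z (by simp) hy hz)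
  have h1 : ∀ z : ℂ, (z = 1 ∨ z = -1) →
      IsFlipDecomposable Y (blochMap V W ((s : ℂ) • 1) ![(d 0 : ℂ), d 1, s * z]) := by
    intro z hz
    have := step 1 ![d 0, 0, s * z]
    rw [l1, l1, l1] at this
    exact this (by simpa using h0 1 z (by simp) hz) (by simpa using h0 (-1) z (by simp) hz)
  have h2 := step 2 ![d 0, d 1, 0]
  rw [l2, l2, l2] at h2
  have h3 := h2 (by simpa using h1 1 (by simp)) (by simpa using h1 (-1) (by simp))
  convert h3 using 2
  ext i
  fin_cases i <;> simp

end Cube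

/-- For a qubit channel `M` there is an operator `Z` such that `X ↦ Tr X • Z - M X` is
decomposable, and whose trace is attained as a communication value by a binary code. -/
theorem exists_dominating (M : Channel (Fin 2) (Fin 2)) :
    ∃ (s : ℝ) (Z : Matrix (Fin 2) (Fin 2) ℂ), 0 ≤ s ∧ Z.trace = 1 + s ∧
      IsFlipDecomposable ((2 : ℂ) • Z) (traceMap Z - M.toLinearMap) ∧
      ∃ ρ E : Bool → Matrix (Fin 2) (Fin 2) ℂ, (∀ y, IsDensity (ρ y)) ∧ IsPOVM E ∧
        ∑ y, (E y * M.toLinearMap (ρ y)).trace.re = 1 + s := by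
  obtain ⟨V, W, d, s, hV, hW, hs, hd, ⟨j, ζ, hζ, hj⟩, hM⟩ := exists_eq_blochMap M
  set D := M.toLinearMap 1 with hDdef
  have hD : D.PosSemidef := M.completelyPositive.posSemidef_apply Matrix.PosSemidef.one
  have hDtr : D.trace = 2 := by rw [hDdef, M.tracePreserving]; simp
  have hsC : (0 : ℂ) ≤ s := by exact_mod_cast hs
  have hζ2 : (ζ : ℂ) * ζ = 1 := by rcases hζ with rfl | rfl <;> simp
  have hMV : M.toLinearMap (V j) = (ζ * s : ℂ) • W j := by
    have horth : ∀ i, (V i * V j).trace = if i = j then 2 else 0 := by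
      intro i
      fin_cases i <;> fin_cases j <;>
        simp [hV.sq, hV.mul01, hV.mul12, hV.mul20, hV.mul10, hV.mul21, hV.mul02, hV.trace]
    rw [hM, blochMap_apply]
    simp [horth, hV.trace, hj, smul_smul]
    congr 1
    ring
  have hpos : ∀ δ : ℂ, star δ = δ → δ * δ = 1 → ∀ {P : Fin 3 → Matrix (Fin 2) (Fin 2) ℂ},
      IsPauliTriple P → (1 + δ • P j).PosSemidef := fun δ h1 h2 P hP =>
    posSemidef_one_add (by rw [Matrix.conjTranspose_smul, h1, hP.herm])
      (by rw [Matrix.smul_mul, Matrix.mul_smul, smul_smul, h2, hP.sq, one_smul])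
  have hMP : ∀ δ : ℂ, M.toLinearMap (1 + δ • V j) = D + (δ * (ζ * s)) • W j := fun δ => by
    rw [map_add, map_smul, hMV, smul_smul]
  have hWdet : (W j).det = -1 := by
    have h1 := Matrix.mul_adjugate (W j)
    rw [← spinFlip_eq_adjugate, spinFlip_apply, hW.trace, zero_smul, zero_sub, mul_neg,
      hW.sq] at h1
    have := congrFun (congrFun h1 0) 0
    simpa [eq_comm] using this
  -- The outputs `D ± ζ * s • W j` of `1 ± V j` have nonnegative determinants; since `det (W j) =
  -- -1`, their average is `det D - s^2`.
  have hdetD : (0 : ℂ) ≤ D.det - s ^ 2 := by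
    have hp := (M.completelyPositive.posSemidef_apply (hpos 1 (by simp) (by simp) hV)).det_nonneg
    have hm := (M.completelyPositive.posSemidef_apply
      (hpos (-1) (by simp) (by simp) hV)).det_nonneg
    have h := mul_nonneg (show (0 : ℂ) ≤ 1 / 2 by norm_num [Complex.le_def]) (add_nonneg hp hm)
    convert h using 1
    rw [hMP, hMP]
    rw [Matrix.det_fin_two] at hWdet
    simp only [Matrix.det_fin_two, Matrix.add_apply, Matrix.smul_apply, smul_eq_mul]
    linear_combination (-(ζ * s : ℂ) ^ 2) * hWdet + ((s : ℂ) ^ 2) * hζ2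
  set Y : Matrix (Fin 2) (Fin 2) ℂ := (s : ℂ) • 1 + D with hYdef
  have hY : Y.PosSemidef := (Matrix.PosSemidef.one.smul hsC).add hD
  have hYtr : Y.trace = 2 * (s + 1) := by
    rw [hYdef, Matrix.trace_add, hDtr]; simp; ring
  have hYdet : Y.det = (2 * s * (s + 1) : ℂ) + (D.det - s ^ 2) := by
    rw [Matrix.trace_fin_two] at hDtr
    rw [hYdef]
    simp [Matrix.det_fin_two]
    linear_combination (s : ℂ) * hDtr
  have hq : Y.det = ((Y.det.re : ℝ) : ℂ) :=
    Complex.ext rfl (by simpa using (Complex.le_def.1 hY.det_nonneg).2.symm)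
  have hsq : 2 * s * (s + 1) ≤ Y.det.re := by
    have h := add_le_add_right hdetD (2 * s * (s + 1) : ℂ)
    rw [← hYdet, add_zero] at h
    have := (Complex.le_def.1 h).1
    simpa using this
  -- The code sends the eigenprojections of `V j` and measures those of `ζ • W j`.
  refine ⟨s, (1 / 2 : ℂ) • Y, hs, ?_, ?_, fun y => (1 / 2 : ℂ) • (1 + (bif y then 1 else -1 : ℂ) • V j),
    fun y => (1 / 2 : ℂ) • (1 + ((bif y then 1 else -1 : ℂ) * ζ) • W j), ?_, ⟨?_, ?_⟩, ?_⟩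
  · rw [Matrix.trace_smul, hYtr, smul_eq_mul]; ring
  -- The `D` in `Y` cancels the one in `M`, leaving the trace term `s • 1` and the coefficients
  -- `-d`.
  · have h := isFlipDecomposable_blochMap (d := fun i => -d i) hV hW
      (fun i => by rw [abs_neg]; exact hd i) hY hs hq hYtr hsq
    rw [smul_smul, show (2 : ℂ) * (1 / 2) = 1 by norm_num, one_smul]
    convert h using 1
    rw [hM, sub_eq_iff_eq_add]
    ext1 X
    simp only [LinearMap.add_apply, blochMap_apply, traceMap_apply, hYdef, Fin.sum_univ_three]
    push_cast
    module
  · intro y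
    refine ⟨(hpos _ ?_ ?_ hV).smul (by norm_num [Complex.le_def]), ?_⟩
    · cases y <;> simp
    · cases y <;> simp
    · simp [hV.trace]
  · intro y
    refine (hpos _ ?_ ?_ hW).smul (by norm_num [Complex.le_def])
    · cases y <;> simp
    · cases y <;> simp [hζ2]
  · simp
    module
  -- The contribution of `D` beyond its trace is odd in `δ` and cancels between the two outcomes.
  · have hval : ∀ δ : ℂ, δ * δ = 1 → (((1 / 2 : ℂ) • (1 + (δ * ζ) • W j)) *
        M.toLinearMap ((1 / 2 : ℂ) • (1 + δ • V j))).trace =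
        (1 / 2 : ℂ) * (1 + s) + δ * (ζ / 4 * (W j * D).trace) := by
      intro δ hδ
      rw [map_smul, hMP]
      simp only [Matrix.smul_mul, Matrix.mul_smul, Matrix.trace_smul, add_mul, mul_add, one_mul,
        Matrix.trace_add, hW.sq, hW.trace, hDtr, Matrix.trace_one, smul_eq_mul, Fintype.card_fin]
      push_cast
      linear_combination (ζ * ζ * s / 2 : ℂ) * hδ + (s / 2 : ℂ) * hζ2
    rw [← Complex.re_sum, Fintype.sum_bool]
    simp only [cond_true, cond_false]
    rw [hval 1 (by simp), hval (-1) (by simp)]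
    have : (1 / 2 : ℂ) * (1 + s) + 1 * (ζ / 4 * (W j * D).trace) +
        ((1 / 2 : ℂ) * (1 + s) + -1 * (ζ / 4 * (W j * D).trace)) = ((1 + s : ℝ) : ℂ) := by
      push_cast; ring
    rw [this, Complex.ofReal_re]

end Decomposition

/-! ### Domination and product codes for tensor products. -/

section Multiplicativity

/-- If `X ↦ Tr X • Z - M X` and `X ↦ Tr X • Z' - N X` are decomposable, then `Z ⊗ₖ Z'` dominates
the outputs of `M ⊗ N`. -/
theorem posSemidef_kronecker_sub_tensor (M N : Channel (Fin 2) (Fin 2))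
    {Z Z' : Matrix (Fin 2) (Fin 2) ℂ}
    (hM : IsFlipDecomposable ((2 : ℂ) • Z) (traceMap Z - M.toLinearMap))
    (hN : IsFlipDecomposable ((2 : ℂ) • Z') (traceMap Z' - N.toLinearMap))
    {ρ : Matrix (Fin 2 × Fin 2) (Fin 2 × Fin 2) ℂ} (hρ : IsDensity ρ) :
    (Z ⊗ₖ Z' - (M.tensor N).toLinearMap ρ).PosSemidef := by
  obtain ⟨K, L, hK, hL, hZL, hMe⟩ := hM
  obtain ⟨K', L', hK', hL', hZL', hNe⟩ := hN
  have htrace : tensorMap (traceMap Z) (traceMap Z') =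
      (Matrix.traceLinearMap (Fin 2 × Fin 2) ℂ ℂ).smulRight (Z ⊗ₖ Z') := by
    apply kronecker_ext
    intro X X'
    simp [tensorMap_kronecker, traceMap_apply, Matrix.trace_kronecker, Matrix.smul_kronecker,
      Matrix.kronecker_smul, smul_smul, mul_comm]
  -- After removing the terms in `K` and `K'`, what is left is `T ⊗ L' + L ⊗ T' - L ⊗ L'` after the
  -- joint flip, by flip invariance of the trace maps `T`, `T'`. The factor `1 / 2` shares the
  -- negative term between the two positive ones, which is why `L` is compared with `2 • Z`.
  have key : tensorMap (traceMap Z) (traceMap Z') - tensorMap M.toLinearMap N.toLinearMap =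
      tensorMap K N.toLinearMap + tensorMap M.toLinearMap K' + tensorMap K K' +
      (1 / 2 : ℂ) • ((tensorMap (traceMap ((2 : ℂ) • Z) - L) L' +
        tensorMap L (traceMap ((2 : ℂ) • Z') - L')) ∘ₗ tensorMap spinFlip spinFlip) := by
    apply kronecker_ext
    intro X X'
    have h1 : M.toLinearMap X = X.trace • Z - K X - L (spinFlip X) := by
      have := LinearMap.congr_fun hMe X
      simp only [LinearMap.sub_apply, LinearMap.add_apply, LinearMap.comp_apply,
        traceMap_apply] at this
      rw [sub_sub, ← this, sub_sub_cancel]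
    have h2 : N.toLinearMap X' = X'.trace • Z' - K' X' - L' (spinFlip X') := by
      have := LinearMap.congr_fun hNe X'
      simp only [LinearMap.sub_apply, LinearMap.add_apply, LinearMap.comp_apply,
        traceMap_apply] at this
      rw [sub_sub, ← this, sub_sub_cancel]
    simp only [LinearMap.sub_apply, LinearMap.add_apply, LinearMap.smul_apply,
      LinearMap.comp_apply, tensorMap_kronecker, h1, h2, traceMap_apply, trace_spinFlip]
    ext p q
    simp only [Matrix.sub_apply, Matrix.add_apply, Matrix.smul_apply, Matrix.kroneckerMap_apply,
      smul_eq_mul]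
    ring
  have hZρ : Z ⊗ₖ Z' - (M.tensor N).toLinearMap ρ =
      (tensorMap (traceMap Z) (traceMap Z') - tensorMap M.toLinearMap N.toLinearMap) ρ := by
    rw [htrace, LinearMap.sub_apply, LinearMap.smulRight_apply, Matrix.traceLinearMap_apply, hρ.2,
      one_smul]
    rfl
  rw [hZρ, key]
  have hflip := posSemidef_tensorMap_spinFlip hρ.1
  refine (((hK.tensorMap N.completelyPositive).posSemidef_apply hρ.1).add
    ((M.completelyPositive.tensorMap hK').posSemidef_apply hρ.1)).add
    ((hK.tensorMap hK').posSemidef_apply hρ.1) |>.add (Matrix.PosSemidef.smul ?_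
      (show (0 : ℂ) ≤ 1 / 2 by norm_num [Complex.le_def]))
  exact ((hZL.tensorMap hL').posSemidef_apply hflip).add
    ((hL.tensorMap hZL').posSemidef_apply hflip)

theorem posSemidef_sub_apply {M : Channel (Fin 2) (Fin 2)} {Y Z : Matrix (Fin 2) (Fin 2) ℂ}
    (hM : IsFlipDecomposable Y (traceMap Z - M.toLinearMap))
    {ρ : Matrix (Fin 2) (Fin 2) ℂ} (hρ : IsDensity ρ) :
    (Z - M.toLinearMap ρ).PosSemidef := by
  obtain ⟨K, L, hK, hL, -, hMe⟩ := hM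
  have h := LinearMap.congr_fun hMe ρ
  rw [LinearMap.sub_apply, traceMap_apply, hρ.2, one_smul] at h
  rw [h]
  exact (hK.posSemidef_apply hρ.1).add (hL.posSemidef_apply (posSemidef_spinFlip hρ.1))

/-- Product codes bound the communication value of a tensor product below. -/
theorem mul_sum_trace_le_cv_tensor {a b a' b' Y Y' : Type*}
    [Fintype a] [DecidableEq a] [Fintype b] [DecidableEq b]
    [Fintype a'] [DecidableEq a'] [Fintype b'] [DecidableEq b']
    [Fintype Y] [Nonempty Y] [Fintype Y'] [Nonempty Y'] (M : Channel a b) (N : Channel a' b')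
    {ρ : Y → Matrix a a ℂ} {E : Y → Matrix b b ℂ} (hρ : ∀ y, IsDensity (ρ y)) (hE : IsPOVM E)
    {ρ' : Y' → Matrix a' a' ℂ} {E' : Y' → Matrix b' b' ℂ} (hρ' : ∀ y, IsDensity (ρ' y))
    (hE' : IsPOVM E') :
    (∑ y, (E y * M.toLinearMap (ρ y)).trace.re) * ∑ y, (E' y * N.toLinearMap (ρ' y)).trace.re ≤
      cv (M.tensor N) := by
  have h := sum_trace_le_cv (Y := Y × Y') (M.tensor N) (ρ := fun y => ρ y.1 ⊗ₖ ρ' y.2)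
    (E := fun y => E y.1 ⊗ₖ E' y.2)
    (fun y => ⟨(hρ y.1).1.kronecker (hρ' y.2).1, by
      rw [Matrix.trace_kronecker, (hρ y.1).2, (hρ' y.2).2, one_mul]⟩)
    ⟨fun y => (hE.1 y.1).kronecker (hE'.1 y.2), by
      rw [Fintype.sum_prod_type, ← Matrix.one_kronecker_one, ← hE.2, ← hE'.2]
      ext p q
      simp [Matrix.sum_apply, Finset.sum_mul_sum]⟩
  refine le_of_eq_of_le ?_ h
  rw [Fintype.sum_prod_type, Finset.sum_mul_sum]
  refine Finset.sum_congr rfl fun y _ => Finset.sum_congr rfl fun y' _ => ?_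
  -- One of the two traces is real, so the real part of the product is the product of the real
  -- parts.
  have him := (Complex.le_def.1
    (trace_mul_nonneg (hE.1 y) (M.isDensity (hρ y)).1)).2
  change _ = ((E y ⊗ₖ E' y') * tensorMap M.toLinearMap N.toLinearMap (ρ y ⊗ₖ ρ' y')).trace.re
  rw [tensorMap_kronecker, ← Matrix.mul_kronecker_mul, Matrix.trace_kronecker, Complex.mul_re,
    ← him]
  simp

end Multiplicativity

end QChannel

theorem mainTheorem6 (M N : QChannel.Channel (Fin 2) (Fin 2)) :
    QChannel.cv (M.tensor N) = QChannel.cv M * QChannel.cv N := by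
  obtain ⟨s, Z, hs, hZ, hM, ρ, E, hρ, hE, hv⟩ := QChannel.exists_dominating M
  obtain ⟨s', Z', hs', hZ', hN, ρ', E', hρ', hE', hv'⟩ := QChannel.exists_dominating N
  have hZr : Z.trace.re = 1 + s := by rw [hZ]; simp
  have hZr' : Z'.trace.re = 1 + s' := by rw [hZ']; simp
  have hZt : (Z ⊗ₖ Z').trace.re = (1 + s) * (1 + s') := by
    rw [Matrix.trace_kronecker, hZ, hZ']; simp
  have hcM : QChannel.cv M = 1 + s := le_antisymm
    (hZr ▸ QChannel.cv_le_of_dominates M (by rw [hZr]; positivity)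
      fun _ h => QChannel.posSemidef_sub_apply hM h)
    (hv ▸ QChannel.sum_trace_le_cv M hρ hE)
  have hcN : QChannel.cv N = 1 + s' := le_antisymm
    (hZr' ▸ QChannel.cv_le_of_dominates N (by rw [hZr']; positivity)
      fun _ h => QChannel.posSemidef_sub_apply hN h)
    (hv' ▸ QChannel.sum_trace_le_cv N hρ' hE')
  rw [hcM, hcN]
  refine le_antisymm (hZt ▸ QChannel.cv_le_of_dominates (M.tensor N) (by rw [hZt]; positivity)
    fun _ h => QChannel.posSemidef_kronecker_sub_tensor M N hM hN h) ?_
  rw [← hv, ← hv']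
  exact QChannel.mul_sum_trace_le_cv_tensor M N hρ hE hρ' hE'
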